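/- Let $R$ be a (Noetherian, commutative) regular ring of prime characteristic $p>0$. For an ideal $I\subseteq R$ and $q=p^e$ let $I^{[q]}$ be the ideal generated by the elements $f^q$, $f\in I$. For a filtration $\mathfrak a_\bullet=\{\mathfrak a_r\}_{r\ge 0}$ of ideals of $R$ put $\nu^I_{\mathfrak a_\bullet}(p^e)=\sup\{r\in\mathbb Z_{\ge 0}:\mathfrak a_r\not\subseteq I^{[p^e]}\}$. If $\limsup_{e\to\infty}\nu^I_{\mathfrak a_\bullet}(p^e)/p^e$ and $\liminf_{e\to\infty}\nu^I_{\mathfrak a_\bullet}(p^e)/p^e$ are equal to the same non-negative real number, this number is denoted by $\mathcal C^I(\mathfrak a_\bullet)$, and we say that $\mathcal C^I(\mathfrak a_\bullet)$ exists. Write $\mathfrak a^\bullet=\{\mathfrak a^n\}_{n\ge 0}$ for the filtration of ordinary powers and $\mathfrak a^{(\bullet)}=\{\mathfrak a^{(n)}\}_{n\ge 0}$ for the filtration of symbolic powers $\mathfrak a^{(n)}=\bigcap_{P\in\operatorname{Ass}(R/\mathfrak a)}(\mathfrak a^nR_P\cap R)$, where $J\cap R$ denotes the preimage of $J \subseteq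 R_P$ under $R\to R_P$. Let $\text{big-height}(\mathfrak a)=\max\{\operatorname{ht}P:P\in\operatorname{Ass}(R/\mathfrak a)\}$. Let $I$ and $\mathfrak a$ be non-zero proper ideals of $R$ such that $\mathfrak a\subseteq\sqrt I$. Then $\text{big-height}(\sqrt{\mathfrak a})$ is finite, all the $F$-thresholds below exist, and for every prime ideal $\mathfrak p$ containing $I$, $$\mathcal C^{\mathfrak p}(\mathfrak a^{(\bullet)})\le \mathcal C^{\sqrt I}(\mathfrak a^{(\bullet)})\le \mathcal C^{\sqrt{\mathfrak a}}(\sqrt{\mathfrak a}^{(\bullet)})\le \text{big-height}(\sqrt{\mathfrak a}).$$ In particular, $\mathcal C^{\sqrt I}(\mathfrak a^{\bullet})$ exists and $$\mathcal C^{\sqrt I}(\mathfrak a^{\bullet})\le\text{big-height}(\sqrt{\mathfrak a}).$$ -/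

import Mathlib

open Filter
open scoped NNReal ENNReal

namespace FThreshold

variable {R : Type*} [CommRing R]

/-- The bracket power `I^{[q]}`: the ideal generated by all `q`-th powers of elements of `I`.
When `q` is a power of the prime characteristic of `R`, this is the usual Frobenius power. -/
def bracketPower (I : Ideal R) (q : ℕ) : Ideal R :=
  Ideal.span ((fun f : R => f ^ q) '' (I : Set R))

/-- The `n`-th symbolic power `𝔞^{(n)} = ⋂_{P ∈ Ass(R/𝔞)} (𝔞^n R_P ∩ R)`, where `J ∩ R` is the
preimage of `J` under the localization map `R → R_P`. -/
noncomputable def symbolicPower (𝔞 : Ideal R) (n : ℕ) : Ideal R :=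
  ⨅ (P : PrimeSpectrum R) (_ : P.asIdeal ∈ associatedPrimes R (R ⧸ 𝔞)),
    ((𝔞 ^ n).map (algebraMap R (Localization.AtPrime P.asIdeal))).comap
      (algebraMap R (Localization.AtPrime P.asIdeal))

/-- The big height of an ideal: the largest height of an associated prime of `R ⧸ 𝔞`. -/
noncomputable def bigHeight (𝔞 : Ideal R) : ℕ∞ :=
  ⨆ P ∈ associatedPrimes R (R ⧸ 𝔞), P.height

/-- `ν_{𝔞_•}^I(q) = sup {r : 𝔞_r ⊄ I^{[q]}}`, with value `-∞` if there is no such `r`,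
and `+∞` if there are arbitrarily large ones. -/
noncomputable def nu (I : Ideal R) (F : ℕ → Ideal R) (q : ℕ) : EReal :=
  ⨆ (r : ℕ) (_ : ¬ F r ≤ bracketPower I q), ((r : ℝ) : EReal)

/-- The upper threshold `C_+^I(𝔞_•) = limsup_e ν(p^e) / p^e`. -/
noncomputable def upperThreshold (p : ℕ) (I : Ideal R) (F : ℕ → Ideal R) : EReal :=
  limsup (fun e : ℕ => nu I F (p ^ e) / (((p : ℝ) ^ e : ℝ) : EReal)) atTop

/-- The lower threshold `C_-^I(𝔞_•) = liminf_e ν(p^e) / p^e`. -/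
noncomputable def lowerThreshold (p : ℕ) (I : Ideal R) (F : ℕ → Ideal R) : EReal :=
  liminf (fun e : ℕ => nu I F (p ^ e) / (((p : ℝ) ^ e : ℝ) : EReal)) atTop

/-- The threshold `C^I(𝔞_•)` exists and equals the non-negative real number `c`: the upper and
the lower threshold are both equal to `c`. -/
def HasFThreshold (p : ℕ) (I : Ideal R) (F : ℕ → Ideal R) (c : ℝ≥0) : Prop :=
  upperThreshold p I F = ((c : ℝ) : EReal) ∧ lowerThreshold p I F = ((c : ℝ) : EReal)

end FThreshold

/-! Everything rests on flatness of Frobenius on a regular ring (Kunz): colon ideals then commute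
with Frobenius powers. Two consequences are used.

Existence: if `f ∉ I^{[q]}` then `f^p ∉ I^{[pq]}`, since otherwise `1 ∈ (I^{[q]} : f)^{[p]} ⊆
(I^{[q]} : f)`. As `f ∈ F r` gives `f^p ∈ F (p * r)` for ordinary and symbolic powers, `ν(p^e)/p^e`
is nondecreasing in `e`. Once bounded, it converges to its supremum, and thresholds can be compared
term by term (`exists_hasFThreshold`).

Bound: for `J` radical of big height at most `h` and `n > hq`, `J^{(n)} ⊆ J^{[q]}`
(`symbolicPower_le_bracketPower`). By flatness this may be tested at the minimal primes `P` of `J`.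
There `J` becomes the maximal ideal of a regular local ring, which has at most `h` generators, and
the pigeonhole principle applies. The case `J = √𝔞` bounds all the other thresholds through
inclusions of ideals.

Flatness of Frobenius is checked locally. A regular local ring has its maximal ideal generated by a
regular sequence, whose `p`-th powers again form a regular sequence. This gives `Tor₁(A/𝔪, B) = 0`
for `B` the ring viewed through Frobenius, and the local criterion concludes. -/

/-! ### Vanishing of `Tor₁(B, A/J)`, expressed as injectivity of `B ⊗ J → B ⊗ A`. -/

section FlatCriterion

open scoped TensorProduct

variable {A : Type*} [CommRing A] (B : Type*) [AddCommGroup B] [Module A B]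

theorem mem_range_lTensor_subtype_iff (J : Ideal A) (c : B ⊗[A] A) :
    c ∈ LinearMap.range (J.subtype.lTensor B) ↔
      TensorProduct.rid A B c ∈ J • (⊤ : Submodule A B) := by
  constructor
  · rintro ⟨t, rfl⟩
    induction t with
    | zero => simp
    | add x y hx hy => rw [map_add, map_add]; exact add_mem hx hy
    | tmul b j =>
      simp only [LinearMap.lTensor_tmul, Submodule.subtype_apply, TensorProduct.rid_tmul]
      exact Submodule.smul_mem_smul j.2 trivial
  · intro h
    have key : ∀ b ∈ J • (⊤ : Submodule A B),
        (TensorProduct.rid A B).symm b ∈ LinearMap.range (J.subtype.lTensor B) := by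
      intro b hb
      induction hb using Submodule.smul_induction_on' with
      | smul r hr n _ =>
        refine ⟨n ⊗ₜ ⟨r, hr⟩, ?_⟩
        simp [← TensorProduct.tmul_smul]
      | add x _ y _ hx hy => rw [map_add]; exact add_mem hx hy
    simpa using key _ h

/-- The presentation of `J + (u)` by `J × A`. -/
def supSpanSingletonMap (J : Ideal A) (u : A) :
    (J × A) →ₗ[A] (J ⊔ Ideal.span {u} : Ideal A) :=
  LinearMap.coprod (Submodule.inclusion le_sup_left)
    (LinearMap.toSpanSingleton A _ ⟨u, Ideal.mem_sup_right (Ideal.mem_span_singleton_self u)⟩)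

theorem supSpanSingletonMap_surjective (J : Ideal A) (u : A) :
    Function.Surjective (supSpanSingletonMap J u) := by
  rintro ⟨x, hx⟩
  obtain ⟨a, ha, b, hb, rfl⟩ := Submodule.mem_sup.1 hx
  obtain ⟨r, rfl⟩ := Ideal.mem_span_singleton'.1 hb
  exact ⟨(⟨a, ha⟩, r), by ext; simp [supSpanSingletonMap]⟩

theorem subtype_comp_supSpanSingletonMap (J : Ideal A) (u : A) :
    (J ⊔ Ideal.span {u} : Ideal A).subtype ∘ₗ supSpanSingletonMap J u =
      J.subtype ∘ₗ LinearMap.fst A J A + u • LinearMap.snd A J A := by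
  ext <;> simp [supSpanSingletonMap]

/-- The kernel of `supSpanSingletonMap`, parametrized by the colon ideal. -/
def colonToProd (J K : Ideal A) (u : A) (hK : ∀ r, r ∈ K ↔ r * u ∈ J) : K →ₗ[A] (J × A) where
  toFun r := (⟨r.1 * u, (hK _).1 r.2⟩, -r.1)
  map_add' x y := by ext <;> simp <;> ring
  map_smul' c x := by ext <;> simp [mul_assoc]

theorem exact_colonToProd (J K : Ideal A) (u : A) (hK : ∀ r, r ∈ K ↔ r * u ∈ J) :
    Function.Exact (colonToProd J K u hK) (supSpanSingletonMap J u) := by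
  rintro ⟨⟨a, ha⟩, r⟩
  have e : ((supSpanSingletonMap J u (⟨a, ha⟩, r) : (J ⊔ Ideal.span {u} : Ideal A)) : A)
      = a + r * u := by simp [supSpanSingletonMap]
  constructor
  · intro h
    rw [h] at e
    have e' : a = -(r * u) := by
      rw [← add_eq_zero_iff_eq_neg]; exact e.symm
    refine ⟨⟨-r, (hK _).2 ?_⟩, ?_⟩
    · rw [neg_mul, ← e']; exact ha
    · ext <;> simp [colonToProd, e']
  · rintro ⟨s, hs⟩
    simp only [colonToProd, LinearMap.coe_mk, AddHom.coe_mk, Prod.mk.injEq, Subtype.mk.injEq] at hs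
    ext
    rw [e, ← hs.1, ← hs.2]
    simp

/-- The sequence `0 → A/(J : u) → A/J → A/(J + (u)) → 0` is exact, so vanishing of `Tor₁` at both
ends forces it in the middle. -/
theorem lTensor_subtype_injective_of_sup_of_colon (J K : Ideal A) (u : A)
    (hK : ∀ r, r ∈ K ↔ r * u ∈ J)
    (hsup : Function.Injective ((J ⊔ Ideal.span {u} : Ideal A).subtype.lTensor B))
    (hcolon : Function.Injective (K.subtype.lTensor B)) :
    Function.Injective (J.subtype.lTensor B) := by
  rw [injective_iff_map_eq_zero]
  intro t ht
  have hex := lTensor_exact B (exact_colonToProd J K u hK) (supSpanSingletonMap_surjective J u)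
  have hz : (supSpanSingletonMap J u).lTensor B ((LinearMap.inl A J A).lTensor B t) = 0 := by
    apply hsup
    rw [map_zero, ← LinearMap.lTensor_comp_apply, ← LinearMap.lTensor_comp_apply]
    have : ((J ⊔ Ideal.span {u} : Ideal A).subtype ∘ₗ supSpanSingletonMap J u) ∘ₗ
        LinearMap.inl A J A = J.subtype := by
      ext; simp [supSpanSingletonMap]
    rw [this, ht]
  obtain ⟨w, hw⟩ := (hex _).1 hz
  have hw0 : w = 0 := by
    apply hcolon
    have h1 := congrArg ((LinearMap.snd A J A).lTensor B) hw
    rw [← LinearMap.lTensor_comp_apply, ← LinearMap.lTensor_comp_apply] at h1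
    have e1 : LinearMap.snd A J A ∘ₗ colonToProd J K u hK = -K.subtype := by
      ext; simp [colonToProd]
    rw [e1, LinearMap.snd_comp_inl] at h1
    rw [map_zero]
    simpa using h1
  rw [hw0, map_zero] at hw
  have h2 := congrArg ((LinearMap.fst A J A).lTensor B) hw
  rw [← LinearMap.lTensor_comp_apply, LinearMap.fst_comp_inl] at h2
  simpa using h2.symm

/-- Same exact sequence, with `hreg` saying that `B/KB → B/JB`, multiplication by `u`, is injective;
the long exact sequence then kills `Tor₁` of `A/(J + (u))`. -/
theorem lTensor_subtype_injective_sup_of_colon (J K : Ideal A) (u : A)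
    (hK : ∀ r, r ∈ K ↔ r * u ∈ J)
    (hJ : Function.Injective (J.subtype.lTensor B))
    (hreg : ∀ b : B, u • b ∈ J • (⊤ : Submodule A B) → b ∈ K • (⊤ : Submodule A B)) :
    Function.Injective ((J ⊔ Ideal.span {u} : Ideal A).subtype.lTensor B) := by
  rw [injective_iff_map_eq_zero]
  intro t ht
  have hex := lTensor_exact B (exact_colonToProd J K u hK) (supSpanSingletonMap_surjective J u)
  obtain ⟨z, rfl⟩ := LinearMap.lTensor_surjective B (supSpanSingletonMap_surjective J u) t
  rw [← LinearMap.lTensor_comp_apply, subtype_comp_supSpanSingletonMap, LinearMap.lTensor_add,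
    LinearMap.lTensor_smul, LinearMap.add_apply, LinearMap.smul_apply,
    LinearMap.lTensor_comp_apply] at ht
  have hc : (LinearMap.snd A J A).lTensor B z ∈ LinearMap.range (K.subtype.lTensor B) := by
    rw [mem_range_lTensor_subtype_iff]
    apply hreg
    rw [← map_smul, ← mem_range_lTensor_subtype_iff]
    refine ⟨-((LinearMap.fst A J A).lTensor B z), ?_⟩
    rw [map_neg, neg_eq_iff_add_eq_zero]
    exact ht
  obtain ⟨w, hw⟩ := hc
  -- Changing the lift `z` by an element of the kernel makes its second coordinate vanish; the first
  -- then vanishes by `hJ`.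
  set z' := z + (colonToProd J K u hK).lTensor B w with hz'
  have hg : (supSpanSingletonMap J u).lTensor B z' = (supSpanSingletonMap J u).lTensor B z := by
    rw [hz', map_add, hex.apply_apply_eq_zero, add_zero]
  have hs : (LinearMap.snd A J A).lTensor B z' = 0 := by
    have e1 : LinearMap.snd A J A ∘ₗ colonToProd J K u hK = -K.subtype := by
      ext; simp [colonToProd]
    rw [hz', map_add, ← hw, ← LinearMap.lTensor_comp_apply, e1]
    simp
  have hf : (LinearMap.fst A J A).lTensor B z' = 0 := by
    apply hJ
    have h0 : ((J ⊔ Ideal.span {u} : Ideal A).subtype ∘ₗ supSpanSingletonMap J u).lTensor B z'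
        = 0 := by
      rw [LinearMap.lTensor_comp_apply, hg, ← LinearMap.lTensor_comp_apply,
        subtype_comp_supSpanSingletonMap, LinearMap.lTensor_add,
        LinearMap.lTensor_smul, LinearMap.add_apply, LinearMap.smul_apply,
        LinearMap.lTensor_comp_apply]
      exact ht
    rw [subtype_comp_supSpanSingletonMap, LinearMap.lTensor_add,
      LinearMap.lTensor_smul, LinearMap.add_apply, LinearMap.smul_apply, hs, smul_zero, add_zero,
      LinearMap.lTensor_comp_apply] at h0
    rw [h0, map_zero]
  have hid : (LinearMap.inl A J A ∘ₗ LinearMap.fst A J A + LinearMap.inr A J A ∘ₗ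
      LinearMap.snd A J A) = LinearMap.id := by ext <;> simp
  have : z' = 0 := by
    have := congrArg (fun l => l.lTensor B z') hid
    simp only [LinearMap.lTensor_add, LinearMap.add_apply, LinearMap.lTensor_comp_apply, hs, hf,
      map_zero, add_zero, LinearMap.lTensor_id, LinearMap.id_apply] at this
    exact this.symm
  rw [← hg, this, map_zero]

theorem lTensor_ofList_subtype_injective (rs : List A)
    (hA : RingTheory.Sequence.IsWeaklyRegular A rs)
    (hB : RingTheory.Sequence.IsWeaklyRegular B rs) :
    Function.Injective ((Ideal.ofList rs).subtype.lTensor B) := by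
  induction rs using List.reverseRecOn with
  | nil =>
    rw [Ideal.ofList_nil]
    intro x y _
    exact Subsingleton.elim x y
  | append_singleton l u ih =>
    rw [RingTheory.Sequence.isWeaklyRegular_append_iff,
      RingTheory.Sequence.isWeaklyRegular_singleton_iff] at hA hB
    rw [Ideal.ofList_append, Ideal.ofList_singleton]
    -- Since `u` is regular modulo `l`, the colon ideal is `(l)` itself.
    refine lTensor_subtype_injective_sup_of_colon B _ (Ideal.ofList l) u ?_ (ih hA.1 hB.1) ?_
    · intro r
      have h := hA.2
      rw [isSMulRegular_quotient_iff_mem_of_smul_mem] at h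
      simp only [smul_eq_mul, Ideal.mul_top] at h
      exact ⟨fun hr => Ideal.mul_mem_right _ _ hr, fun hr => h r (by rwa [mul_comm])⟩
    · have h := hB.2
      rw [isSMulRegular_quotient_iff_mem_of_smul_mem] at h
      exact h

/-- Noetherian induction replaces the filtration of `A/J` by copies of `A/m`: an associated prime
`(J : u)` of `A/J` contains `m ^ n`, hence equals `m`, and `J + (u)` is strictly larger than `J`. -/
theorem lTensor_subtype_injective_of_pow_le [IsNoetherianRing A] (m : Ideal A) [m.IsMaximal]
    (hm : Function.Injective (m.subtype.lTensor B)) (n : ℕ) (J : Ideal A) (hJ : m ^ n ≤ J) :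
    Function.Injective (J.subtype.lTensor B) := by
  induction J using WellFoundedGT.induction with
  | ind J ih =>
    by_cases hJt : J = ⊤
    · subst hJt
      exact (LinearEquiv.lTensor B (Submodule.topEquiv (R := A) (M := A))).injective
    · have : Nontrivial (A ⧸ J) := Ideal.Quotient.nontrivial_iff.2 hJt
      obtain ⟨P, hP⟩ := associatedPrimes.nonempty A (A ⧸ J)
      obtain ⟨hPp, x, hx⟩ := isAssociatedPrime_iff.1 hP
      obtain ⟨u, rfl⟩ := Ideal.Quotient.mk_surjective x
      have hK : ∀ r, r ∈ P ↔ r * u ∈ J := by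
        intro r
        rw [hx, Submodule.mem_colon_singleton, Submodule.mem_bot, ← Ideal.Quotient.eq_zero_iff_mem,
          map_mul]
        rfl
      have hJP : J ≤ P := fun r hr => (hK r).2 (J.mul_mem_right _ hr)
      have hmP : m = P := Ideal.IsMaximal.eq_of_le inferInstance hPp.ne_top
        (hPp.le_of_pow_le (hJ.trans hJP))
      have huJ : u ∉ J := fun hu => hPp.ne_top ((Ideal.eq_top_iff_one _).2 ((hK 1).2 (by simpa)))
      refine lTensor_subtype_injective_of_sup_of_colon B J P u hK (ih _ ?_ (hJ.trans le_sup_left))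
        (hmP ▸ hm)
      refine lt_of_le_of_ne le_sup_left fun h => huJ ?_
      rw [h]
      exact Ideal.mem_sup_right (Ideal.mem_span_singleton_self u)

/-- The map `J × M → J + M`, whose kernel is a copy of `J ∩ M`. -/
def supMap (J M : Ideal A) : (J × M) →ₗ[A] (J ⊔ M : Ideal A) :=
  LinearMap.coprod (Submodule.inclusion le_sup_left) (Submodule.inclusion le_sup_right)

theorem supMap_surjective (J M : Ideal A) : Function.Surjective (supMap J M) := by
  rintro ⟨x, hx⟩
  obtain ⟨a, ha, b, hb, rfl⟩ := Submodule.mem_sup.1 hx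
  exact ⟨(⟨a, ha⟩, ⟨b, hb⟩), by ext; simp [supMap]⟩

/-- The antidiagonal embedding of `J ∩ M` in `J × M`. -/
def infToProd (J M : Ideal A) : (J ⊓ M : Ideal A) →ₗ[A] (J × M) :=
  LinearMap.prod (Submodule.inclusion inf_le_left) (-(Submodule.inclusion inf_le_right))

theorem exact_infToProd (J M : Ideal A) : Function.Exact (infToProd J M) (supMap J M) := by
  rintro ⟨⟨a, ha⟩, ⟨b, hb⟩⟩
  have e : ((supMap J M (⟨a, ha⟩, ⟨b, hb⟩) : (J ⊔ M : Ideal A)) : A) = a + b := by simp [supMap]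
  constructor
  · intro h
    rw [h] at e
    have e' : a = -b := by rw [← add_eq_zero_iff_eq_neg]; exact e.symm
    refine ⟨⟨a, ha, by rw [e']; exact M.neg_mem hb⟩, ?_⟩
    ext <;> simp [infToProd, e']
  · rintro ⟨s, hs⟩
    have h1 : (s : A) = a := congrArg (fun z => ((Prod.fst z : J) : A)) hs
    have h2 : -(s : A) = b := congrArg (fun z => ((Prod.snd z : M) : A)) hs
    ext
    rw [e, ← h1, ← h2]
    simp

theorem exists_lTensor_inclusion_eq (J M : Ideal A)
    (h : Function.Injective ((J ⊔ M : Ideal A).subtype.lTensor B)) (t : B ⊗[A] J)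
    (ht : J.subtype.lTensor B t = 0) :
    ∃ w, (Submodule.inclusion (inf_le_left : J ⊓ M ≤ J)).lTensor B w = t := by
  have hz : (supMap J M).lTensor B ((LinearMap.inl A J M).lTensor B t) = 0 := by
    apply h
    rw [map_zero, ← LinearMap.lTensor_comp_apply, ← LinearMap.lTensor_comp_apply]
    have : ((J ⊔ M : Ideal A).subtype ∘ₗ supMap J M) ∘ₗ LinearMap.inl A J M = J.subtype := by
      ext; simp [supMap]
    rw [this, ht]
  obtain ⟨w, hw⟩ := (lTensor_exact B (exact_infToProd J M) (supMap_surjective J M) _).1 hz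
  refine ⟨w, ?_⟩
  have h2 := congrArg ((LinearMap.fst A J M).lTensor B) hw
  rw [← LinearMap.lTensor_comp_apply, ← LinearMap.lTensor_comp_apply, LinearMap.fst_comp_inl] at h2
  simpa [infToProd] using h2

end FlatCriterion

/-! ### The local criterion of flatness. -/

section LocalCriterion

open IsLocalRing
open scoped TensorProduct

/-- A form of the local criterion of flatness. -/
theorem flat_of_lTensor_maximalIdeal_subtype_injective {A B : Type*} [CommRing A] [CommRing B]
    [Algebra A B] [IsLocalRing A] [IsNoetherianRing A] [IsLocalRing B] [IsNoetherianRing B]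
    [IsLocalHom (algebraMap A B)]
    (hm : Function.Injective ((maximalIdeal A).subtype.lTensor B)) : Module.Flat A B := by
  rw [Module.Flat.iff_lTensor_injective]
  intro J _
  rw [injective_iff_map_eq_zero]
  intro t ht
  obtain ⟨k, hk⟩ := Ideal.exists_pow_inf_eq_pow_smul (maximalIdeal A) J
  -- The kernel element `t` comes from `J ∩ 𝔪^(i+k)`, which Artin–Rees puts inside `𝔪^i J`. Krull's
  -- intersection theorem for the finite `B`-module `B ⊗ J` then gives `t = 0`.
  have key : ∀ i : ℕ, t ∈ maximalIdeal B ^ i • (⊤ : Submodule B (B ⊗[A] J)) := by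
    intro i
    obtain ⟨w, hw⟩ := exists_lTensor_inclusion_eq B J (maximalIdeal A ^ (i + k))
      (lTensor_subtype_injective_of_pow_le B _ hm (i + k) _ le_sup_right) t ht
    have hle : J ⊓ maximalIdeal A ^ (i + k) ≤ maximalIdeal A ^ i • J := by
      have h := hk (i + k) (Nat.le_add_left _ _)
      rw [Nat.add_sub_cancel, smul_eq_mul, Ideal.mul_top] at h
      rw [inf_comm, h]
      exact Submodule.smul_mono le_rfl inf_le_right
    have hmap : ∀ r ∈ maximalIdeal A ^ i, algebraMap A B r ∈ maximalIdeal B ^ i := by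
      intro r hr
      have h1 : (maximalIdeal A).map (algebraMap A B) ≤ maximalIdeal B :=
        ((local_hom_TFAE (algebraMap A B)).out 0 2).1 ‹_›
      have h2 := Ideal.mem_map_of_mem (algebraMap A B) hr
      rw [Ideal.map_pow] at h2
      exact Ideal.pow_right_mono h1 i h2
    rw [← hw]
    clear hw
    induction w with
    | zero => simp
    | add x y hx hy => rw [map_add]; exact add_mem hx hy
    | tmul b j =>
      rw [LinearMap.lTensor_tmul]
      have hj : Submodule.inclusion (inf_le_left : J ⊓ maximalIdeal A ^ (i + k) ≤ J) j ∈
          maximalIdeal A ^ i • (⊤ : Submodule A J) := by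
        rw [Submodule.mem_smul_top_iff]
        exact hle j.2
      generalize Submodule.inclusion (inf_le_left : J ⊓ maximalIdeal A ^ (i + k) ≤ J) j = j' at hj ⊢
      induction hj using Submodule.smul_induction_on' with
      | smul r hr n _ =>
        rw [TensorProduct.tmul_smul, ← algebraMap_smul B r (b ⊗ₜ[A] n)]
        exact Submodule.smul_mem_smul (hmap r hr) Submodule.mem_top
      | add x _ y _ hx hy => rw [TensorProduct.tmul_add]; exact add_mem hx hy
  have hbot := Ideal.iInf_pow_smul_eq_bot_of_isLocalRing (M := B ⊗[A] J) (maximalIdeal B)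
    (maximalIdeal.isMaximal B).ne_top
  have : t ∈ (⨅ i : ℕ, maximalIdeal B ^ i • ⊤ : Submodule B (B ⊗[A] J)) := by
    rw [Submodule.mem_iInf]; exact key
  rwa [hbot] at this

end LocalCriterion

/-! ### Regular local rings, regular sequences and flatness of Frobenius. -/

section RegularLocal

open IsLocalRing RingTheory.Sequence

/-- Prime avoidance tolerates the non-prime `𝔪²`. Containment of `𝔪` in `𝔪²` is excluded by
Nakayama; containment in a minimal prime would give dimension zero, hence `𝔪 = 0` by regularity. -/
theorem exists_mem_maximalIdeal_notMem {A : Type*} [CommRing A] [IsRegularLocalRing A]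
    (h : maximalIdeal A ≠ ⊥) :
    ∃ x ∈ maximalIdeal A, x ∉ maximalIdeal A ^ 2 ∧ ∀ P ∈ minimalPrimes A, x ∉ P := by
  classical
  by_contra! hcon
  have hfin : (minimalPrimes A).Finite := minimalPrimes.finite_of_isNoetherianRing A
  have hsub : (maximalIdeal A : Set A) ⊆
      ⋃ i ∈ ((insert (maximalIdeal A ^ 2) hfin.toFinset : Finset (Ideal A)) : Set (Ideal A)),
        ((id i : Ideal A) : Set A) := by
    intro x hx
    by_cases hx2 : x ∈ maximalIdeal A ^ 2
    · exact Set.mem_biUnion (by simp) hx2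
    · obtain ⟨P, hP, hxP⟩ := hcon x hx hx2
      exact Set.mem_biUnion (x := P) (by simp [hP]) hxP
  rw [Ideal.subset_union_prime (maximalIdeal A ^ 2) (maximalIdeal A ^ 2)] at hsub
  · obtain ⟨P, hP, hle⟩ := hsub
    rw [Finset.mem_insert, Set.Finite.mem_toFinset] at hP
    rcases hP with rfl | hP
    · apply h
      refine Submodule.eq_bot_of_le_smul_of_le_jacobson_bot (maximalIdeal A) _
        (maximalIdeal A).fg_of_isNoetherianRing ?_ (maximalIdeal_le_jacobson _)
      simpa [pow_two] using hle
    · have hPp : P.IsPrime := hP.1.1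
      have hPm : P = maximalIdeal A := le_antisymm (le_maximalIdeal hPp.ne_top) hle
      have h0 : (maximalIdeal A).height = 0 := by
        rw [← hPm]
        exact Ideal.height_eq_zero_iff.2 hP
      have hdim := maximalIdeal_height_eq_ringKrullDim (R := A)
      rw [h0, ← IsRegularLocalRing.spanFinrank_maximalIdeal] at hdim
      apply h
      rw [← Submodule.spanFinrank_eq_zero_iff_eq_bot (maximalIdeal A).fg_of_isNoetherianRing]
      exact_mod_cast hdim.symm
  · intro P hP hne _
    simp only [Finset.mem_insert, hne, Set.Finite.mem_toFinset, false_or] at hP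
    exact hP.1.1

/-- As `x ∉ 𝔪²`, some coefficient of `x` in a minimal generating set is a unit, so that generator is
redundant modulo `x`. -/
theorem spanFinrank_maximalIdeal_quotient_add_one_le {A : Type*} [CommRing A] [IsLocalRing A]
    [IsNoetherianRing A] {x : A} (hx : x ∈ maximalIdeal A) (hx2 : x ∉ maximalIdeal A ^ 2) :
    ((maximalIdeal A).map (Ideal.Quotient.mk (Ideal.span {x}))).spanFinrank + 1 ≤
      (maximalIdeal A).spanFinrank := by
  classical
  obtain ⟨S, hcard, hspan⟩ := Submodule.FG.exists_span_finset_card_eq_spanFinrank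
    (maximalIdeal A).fg_of_isNoetherianRing
  have hSm : ∀ s ∈ S, s ∈ maximalIdeal A := fun s hs => hspan ▸ Submodule.subset_span hs
  have hx' := hx
  rw [← hspan, Submodule.mem_span_finset] at hx'
  obtain ⟨c, -, hc⟩ := hx'
  obtain ⟨s, hs, hu⟩ : ∃ s ∈ S, IsUnit (c s) := by
    by_contra! hcon
    apply hx2
    rw [← hc, pow_two]
    exact Ideal.sum_mem _ fun s hs => Ideal.mul_mem_mul (hcon s hs) (hSm s hs)
  have hmap : (maximalIdeal A).map (Ideal.Quotient.mk (Ideal.span {x})) =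
      Ideal.span (((S.erase s).image (Ideal.Quotient.mk (Ideal.span {x})) : Finset _) : Set _) := by
    apply le_antisymm
    · rw [← hspan]
      change Ideal.map _ (Ideal.span _) ≤ _
      rw [Ideal.map_span, Ideal.span_le]
      rintro _ ⟨t, ht, rfl⟩
      have hmem : ∀ t ∈ S.erase s, Ideal.Quotient.mk (Ideal.span {x}) t ∈
          Ideal.span (((S.erase s).image (Ideal.Quotient.mk (Ideal.span {x})) : Finset _) :
            Set (A ⧸ Ideal.span {x})) := fun t ht =>
        Ideal.subset_span (Finset.mem_coe.2 (Finset.mem_image_of_mem _ ht))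
      by_cases hts : t = s
      · subst hts
        have h0 : Ideal.Quotient.mk (Ideal.span {x}) x = 0 :=
          Ideal.Quotient.eq_zero_iff_mem.2 (Ideal.mem_span_singleton_self x)
        conv at h0 => enter [1, 2]; rw [← hc]
        rw [← Finset.add_sum_erase _ _ hs, map_add, add_eq_zero_iff_eq_neg, smul_eq_mul,
          map_mul] at h0
        rw [SetLike.mem_coe, ← Ideal.unit_mul_mem_iff_mem _ (hu.map (Ideal.Quotient.mk _)), h0,
          map_sum]
        refine neg_mem (Ideal.sum_mem _ fun i hi => ?_)
        rw [smul_eq_mul, map_mul]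
        exact Ideal.mul_mem_left _ _ (hmem i hi)
      · exact hmem t (Finset.mem_erase.2 ⟨hts, ht⟩)
    · rw [Ideal.span_le]
      intro t ht
      obtain ⟨r, hr, rfl⟩ := Finset.mem_image.1 (Finset.mem_coe.1 ht)
      exact Ideal.mem_map_of_mem _ (hSm r (Finset.mem_of_mem_erase hr))
  rw [hmap, ← hcard]
  calc _ ≤ (S.erase s).card + 1 := by
        gcongr
        refine (Submodule.spanFinrank_span_le_ncard_of_finite (Finset.finite_toSet _)).trans ?_
        rw [Set.ncard_coe_finset]
        exact Finset.card_image_le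
    _ = S.card := Finset.card_erase_add_one hs

theorem IsRegularLocalRing.quotient_span_singleton {A : Type*} [CommRing A] [IsRegularLocalRing A]
    {x : A} (hx : x ∈ maximalIdeal A) (hx2 : x ∉ maximalIdeal A ^ 2) :
    ∃ _ : IsRegularLocalRing (A ⧸ Ideal.span {x}),
      (maximalIdeal (A ⧸ Ideal.span {x})).spanFinrank + 1 ≤ (maximalIdeal A).spanFinrank ∧
      (maximalIdeal A).map (Ideal.Quotient.mk (Ideal.span {x})) =
        maximalIdeal (A ⧸ Ideal.span {x}) := by
  have hne : Ideal.span {x} ≠ ⊤ := fun h =>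
    (maximalIdeal.isMaximal A).ne_top (top_le_iff.1 (h ▸ (Ideal.span_singleton_le_iff_mem _).2 hx))
  have : Nontrivial (A ⧸ Ideal.span {x}) := Ideal.Quotient.nontrivial_iff.2 hne
  have hloc : IsLocalRing (A ⧸ Ideal.span {x}) :=
    IsLocalRing.of_surjective' _ Ideal.Quotient.mk_surjective
  have hmap : (maximalIdeal A).map (Ideal.Quotient.mk (Ideal.span {x})) =
      maximalIdeal (A ⧸ Ideal.span {x}) :=
    IsLocalRing.map_maximalIdeal_of_surjective _ Ideal.Quotient.mk_surjective
  have hle := spanFinrank_maximalIdeal_quotient_add_one_le hx hx2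
  rw [hmap] at hle
  refine ⟨IsRegularLocalRing.of_spanFinrank_maximalIdeal_le _ ?_, hle, hmap⟩
  -- The dimension drops by at most one and the embedding dimension by at least one, so regularity
  -- survives.
  have h1 := Ideal.height_le_ringKrullDim_quotient_add_one hx
  rw [maximalIdeal_height_eq_ringKrullDim, ← IsRegularLocalRing.spanFinrank_maximalIdeal] at h1
  rw [← maximalIdeal_height_eq_ringKrullDim] at h1 ⊢
  have h2 : ((maximalIdeal A).spanFinrank : ℕ∞) ≤
      (maximalIdeal (A ⧸ Ideal.span {x})).height + 1 := by exact_mod_cast h1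
  have h3 : ((maximalIdeal (A ⧸ Ideal.span {x})).spanFinrank : ℕ∞) + 1 ≤
      (maximalIdeal (A ⧸ Ideal.span {x})).height + 1 := le_trans (by exact_mod_cast hle) h2
  exact_mod_cast (ENat.add_le_add_iff_right ENat.one_ne_top).1 h3

/-- A minimal prime `P` inside the prime `(x)` does not contain `x`, so `P = xP`, and Nakayama gives
`P = 0`. -/
theorem isDomain_of_isDomain_quotient_span_singleton {A : Type*} [CommRing A] [IsLocalRing A]
    [IsNoetherianRing A] {x : A} (hx : x ∈ maximalIdeal A) (hmin : ∀ P ∈ minimalPrimes A, x ∉ P)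
    (h : IsDomain (A ⧸ Ideal.span {x})) : IsDomain A := by
  have hp : (Ideal.span {x}).IsPrime := (Ideal.Quotient.isDomain_iff_prime _).1 h
  obtain ⟨P, hP, hPx⟩ := Ideal.exists_minimalPrimes_le (bot_le : ⊥ ≤ Ideal.span {x})
  have hPp : P.IsPrime := hP.1.1
  have hbot : P = ⊥ := by
    refine Submodule.eq_bot_of_le_smul_of_le_jacobson_bot (maximalIdeal A) _
        P.fg_of_isNoetherianRing ?_ (maximalIdeal_le_jacobson _)
    intro y hy
    obtain ⟨z, rfl⟩ := Ideal.mem_span_singleton'.1 (hPx hy)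
    rw [mul_comm]
    exact Submodule.smul_mem_smul hx ((hPp.mem_or_mem hy).resolve_right (hmin P hP))
  rw [hbot] at hPp
  exact (IsDomain.of_bot_isPrime A)

/-- Both claims are proved together by induction on the embedding dimension: being a domain is what
makes `x` a nonzerodivisor. -/
theorem IsRegularLocalRing.isDomain_and_exists_isWeaklyRegular (n : ℕ) :
    ∀ (A : Type*) [CommRing A] [IsRegularLocalRing A], (maximalIdeal A).spanFinrank = n →
      IsDomain A ∧ ∃ rs : List A, IsWeaklyRegular A rs ∧ Ideal.ofList rs = maximalIdeal A := by
  induction n using Nat.strong_induction_on with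
  | _ n ih =>
  intro A _ _ hn
  by_cases hbot : maximalIdeal A = ⊥
  · refine ⟨?_, [], IsWeaklyRegular.nil A A, by rw [Ideal.ofList_nil, hbot]⟩
    have := (maximalIdeal.isMaximal A).isPrime
    rw [hbot] at this
    exact IsDomain.of_bot_isPrime A
  · obtain ⟨x, hx, hx2, hmin⟩ := exists_mem_maximalIdeal_notMem hbot
    obtain ⟨hreg, hle, hmap⟩ := IsRegularLocalRing.quotient_span_singleton hx hx2
    obtain ⟨hdom, rs, hrs, hof⟩ := ih _ (by omega) (A ⧸ Ideal.span {x}) rfl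
    have hdomA := isDomain_of_isDomain_quotient_span_singleton hx hmin hdom
    refine ⟨hdomA, ?_⟩
    obtain ⟨l, rfl⟩ := List.map_surjective_iff.2
      (Ideal.Quotient.mk_surjective (I := Ideal.span {x})) rs
    refine ⟨x :: l, ?_, ?_⟩
    · rw [isWeaklyRegular_cons_iff']
      refine ⟨?_, ?_⟩
      · have hx0 : x ≠ 0 := by rintro rfl; exact hx2 (Ideal.zero_mem _)
        exact fun a b hab => mul_left_cancel₀ hx0 hab
      · have e : (A ⧸ Ideal.span {x}) ≃ₗ[A ⧸ Ideal.span {x}] QuotSMulTop x A := by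
          refine (Submodule.quotEquivOfEq _ _ ?_).extendScalarsOfSurjective
            Ideal.Quotient.mk_surjective
          simp [← Submodule.ideal_span_singleton_smul]
        exact (e.isWeaklyRegular_congr _).1 hrs
    · rw [Ideal.ofList_cons]
      rw [← Ideal.map_ofList, ← hmap] at hof
      have := congrArg (Ideal.comap (Ideal.Quotient.mk (Ideal.span {x}))) hof
      rw [Ideal.comap_map_of_surjective _ Ideal.Quotient.mk_surjective,
        Ideal.comap_map_of_surjective _ Ideal.Quotient.mk_surjective, ← RingHom.ker_eq_comap_bot,
        Ideal.mk_ker] at this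
      rw [sup_comm, this, sup_eq_left]
      exact (Ideal.span_singleton_le_iff_mem _).2 hx

/-- Regular sequences in the maximal ideal are permutable, so `x` can be moved to the end, raised to
a power there, and moved back. -/
theorem RingTheory.Sequence.IsWeaklyRegular.map_pow {A : Type*} [CommRing A] [IsLocalRing A]
    [IsNoetherianRing A] {n : ℕ} (hn : n ≠ 0) (rs : List A) (hrs : ∀ r ∈ rs, r ∈ maximalIdeal A) :
    ∀ (M : Type*) [AddCommGroup M] [Module A M] [IsNoetherian A M],
      IsWeaklyRegular M rs → IsWeaklyRegular M (rs.map (· ^ n)) := by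
  induction rs with
  | nil => intro M _ _ _ h; exact h
  | cons x xs ih =>
    intro M _ _ _ h
    have h1 : IsWeaklyRegular M (xs ++ [x]) :=
      isWeaklyRegular_of_perm_of_subset_maximalIdeal h (List.perm_append_singleton x xs).symm hrs
    rw [isWeaklyRegular_append_iff, isWeaklyRegular_singleton_iff] at h1
    have h2 : IsWeaklyRegular M (xs ++ [x ^ n]) := by
      rw [isWeaklyRegular_append_iff, isWeaklyRegular_singleton_iff]
      exact ⟨h1.1, h1.2.pow n⟩
    have h3 : IsWeaklyRegular M (x ^ n :: xs) := by
      refine isWeaklyRegular_of_perm_of_subset_maximalIdeal h2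
        (List.perm_append_singleton _ xs) ?_
      intro r hr
      simp only [List.mem_append, List.mem_singleton] at hr
      rcases hr with hr | rfl
      · exact hrs r (List.mem_cons_of_mem _ hr)
      · exact Ideal.pow_mem_of_mem _ (hrs x List.mem_cons_self) n (Nat.pos_of_ne_zero hn)
    rw [isWeaklyRegular_cons_iff] at h3
    rw [List.map_cons, isWeaklyRegular_cons_iff]
    exact ⟨h3.1, ih (fun r hr => hrs r (List.mem_cons_of_mem _ hr)) _ h3.2⟩

/-- Frobenius is flat on a regular local ring. -/
theorem frobenius_flat_of_isRegularLocalRing {A : Type*} [CommRing A] [IsRegularLocalRing A]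
    (p : ℕ) [hp : Fact p.Prime] [CharP A p] : (frobenius A p).Flat := by
  obtain ⟨-, rs, hrs, hof⟩ :=
    IsRegularLocalRing.isDomain_and_exists_isWeaklyRegular _ A rfl
  have hmem : ∀ r ∈ rs, r ∈ maximalIdeal A := fun r hr => hof ▸ Ideal.subset_span hr
  have hloc : IsLocalHom (frobenius A p) :=
    ⟨fun a ha => by rw [frobenius_def] at ha; exact (isUnit_pow_iff hp.out.ne_zero).1 ha⟩
  have hpow : IsWeaklyRegular A (rs.map (frobenius A p)) :=
    hrs.map_pow hp.out.ne_zero rs hmem A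
  -- A separate name `B` for the target keeps the Frobenius algebra structure apart from that of `A`
  -- over itself.
  suffices H : ∀ (B : Type _) [CommRing B] [Algebra A B] [IsLocalRing B] [IsNoetherianRing B]
      [IsLocalHom (algebraMap A B)], IsWeaklyRegular B (rs.map (algebraMap A B)) →
      Module.Flat A B from
    @H A _ (frobenius A p).toAlgebra _ _ hloc hpow
  intro B _ _ _ _ _ hB
  apply flat_of_lTensor_maximalIdeal_subtype_injective
  rw [← hof]
  exact lTensor_ofList_subtype_injective B rs hrs ((isWeaklyRegular_map_algebraMap_iff B B rs).1 hB)

/-- Frobenius is flat on a regular ring. -/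
theorem frobenius_flat_of_isRegularRing {A : Type*} [CommRing A] [IsRegularRing A]
    (p : ℕ) [hp : Fact p.Prime] [CharP A p] : (frobenius A p).Flat := by
  apply RingHom.Flat.ofLocalizationPrime
  intro P hP
  have hchar : CharP (Localization.AtPrime P) p := by
    rw [CharP.charP_iff_prime_eq_zero hp.out, ← map_natCast (algebraMap A _), CharP.cast_eq_zero,
      map_zero]
  -- Frobenius pulls `P` back to `P`; a variable `Q` allows this equality to be substituted.
  have key : ∀ (Q : Ideal A) [Q.IsPrime] (hQ : Q = P.comap (frobenius A p)),
      (Localization.localRingHom Q P (frobenius A p) hQ).Flat := by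
    intro Q _ hQ
    have hQP : Q = P := by
      rw [hQ]
      ext a
      rw [Ideal.mem_comap, frobenius_def, hP.pow_mem_iff_mem _ hp.out.pos]
    subst hQP
    have : Localization.localRingHom Q Q (frobenius A p) hQ =
        frobenius (Localization.AtPrime Q) p := by
      apply Localization.localRingHom_unique
      intro a
      simp [frobenius_def]
    rw [this]
    exact frobenius_flat_of_isRegularLocalRing p
  exact key _ rfl

end RegularLocal

/-! ### Flat maps and colon ideals, associated primes of radical ideals. -/

section FrobeniusPowers

open IsLocalRing

/-- By the equational criterion, the relation `b s = ∑ cᵢ gᵢ` is a `B`-combination of relations over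
`A`, and the coefficient of `s` in each of these lies in `(J : s) ⊆ K`. -/
theorem Module.Flat.mem_map_algebraMap_of_mul_mem {A B : Type*} [CommRing A] [CommRing B]
    [Algebra A B] [Module.Flat A B] {J K : Ideal A} {s : A} (hK : ∀ r, r * s ∈ J → r ∈ K) {b : B}
    (hb : b * algebraMap A B s ∈ J.map (algebraMap A B)) : b ∈ K.map (algebraMap A B) := by
  obtain ⟨n, g, c, hgc⟩ : ∃ (n : ℕ) (g : Fin n → J) (c : Fin n → B),
      b * algebraMap A B s = ∑ i, c i * algebraMap A B (g i) := by
    rw [Ideal.map, Ideal.span, Submodule.mem_span_set'] at hb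
    obtain ⟨n, c, g, h⟩ := hb
    choose a ha hag using fun i => (g i).2
    refine ⟨n, fun i => ⟨a i, ha i⟩, c, ?_⟩
    rw [← h]
    exact Finset.sum_congr rfl fun i _ => by rw [hag, smul_eq_mul]
  obtain ⟨F, hF0, hFs⟩ : ∃ F : Fin (n + 1) → A, F 0 = s ∧ ∀ i : Fin n, F i.succ = -(g i : A) :=
    ⟨Fin.cons s fun i => -(g i : A), rfl, fun _ => rfl⟩
  obtain ⟨X, hX0, hXs⟩ : ∃ X : Fin (n + 1) → B, X 0 = b ∧ ∀ i : Fin n, X i.succ = c i :=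
    ⟨Fin.cons b c, rfl, fun _ => rfl⟩
  have hrel : ∑ i, F i • X i = 0 := by
    rw [Fin.sum_univ_succ]
    simp only [hF0, hFs, hX0, hXs, neg_smul, Finset.sum_neg_distrib]
    simp only [Algebra.smul_def]
    rw [mul_comm, hgc, add_neg_eq_zero]
    exact Finset.sum_congr rfl fun i _ => mul_comm _ _
  obtain ⟨k, a, y, h1, h2⟩ := Module.Flat.isTrivialRelation_of_sum_smul_eq_zero (R := A) (M := B) hrel
  rw [← hX0, h1 0]
  refine Ideal.sum_mem _ fun j _ => ?_
  rw [Algebra.smul_def]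
  refine Ideal.mul_mem_right _ _ (Ideal.mem_map_of_mem _ (hK _ ?_))
  have h3 := h2 j
  rw [Fin.sum_univ_succ] at h3
  simp only [hF0, hFs, neg_mul, Finset.sum_neg_distrib, add_neg_eq_zero] at h3
  rw [mul_comm, h3]
  exact Ideal.sum_mem _ fun i _ => Ideal.mul_mem_right _ _ (g i).2

theorem RingHom.Flat.mem_map_of_mul_mem_map {A B : Type*} [CommRing A] [CommRing B] {f : A →+* B}
    (hf : f.Flat) {J K : Ideal A} {s : A} (hK : ∀ r, r * s ∈ J → r ∈ K) {b : B}
    (hb : b * f s ∈ J.map f) : b ∈ K.map f :=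
  @Module.Flat.mem_map_algebraMap_of_mul_mem A B _ _ f.toAlgebra hf J K s hK b hb

theorem iterateFrobenius_flat {A : Type*} [CommRing A] [IsRegularRing A]
    (p : ℕ) [Fact p.Prime] [CharP A p] (e : ℕ) : (iterateFrobenius A p e).Flat := by
  induction e with
  | zero =>
    rw [iterateFrobenius_zero]
    exact RingHom.Flat.id A
  | succ e ih =>
    have : iterateFrobenius A p (e + 1) = (frobenius A p).comp (iterateFrobenius A p e) := by
      ext x
      simp [iterateFrobenius_def, frobenius_def, pow_succ, pow_mul]
    rw [this]
    exact ih.comp (frobenius_flat_of_isRegularRing p)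

/-- Pigeonhole: a monomial of this degree contains some generator to the power `q`. -/
theorem span_finset_pow_le {A : Type*} [CommRing A] (S : Finset A) (q : ℕ) :
    Ideal.span (S : Set A) ^ (S.card * q + 1) ≤ Ideal.span ((fun s => s ^ q) '' (S : Set A)) := by
  classical
  induction S using Finset.induction_on with
  | empty => simp
  | insert a S ha ih =>
    rw [Finset.card_insert_of_notMem ha, Finset.coe_insert, Ideal.span_insert, Set.image_insert_eq,
      Ideal.span_insert]
    rw [show (S.card + 1) * q + 1 = q + (S.card * q + 1) by ring]
    refine (Ideal.sup_pow_add_le_pow_sup_pow).trans (sup_le_sup ?_ ih)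
    rw [Ideal.span_singleton_pow]

theorem IsLocalization.AtPrime.map_eq_maximalIdeal_of_mem_minimalPrimes {A : Type*} [CommRing A]
    {J P : Ideal A} [P.IsPrime] (hJ : J.IsRadical) (hP : P ∈ J.minimalPrimes) :
    J.map (algebraMap A (Localization.AtPrime P)) = maximalIdeal (Localization.AtPrime P) := by
  rw [← Localization.AtPrime.map_eq_maximalIdeal]
  refine le_antisymm (Ideal.map_mono hP.1.2) (Ideal.map_le_iff_le_comap.2 fun x hx => ?_)
  have hrad : algebraMap A (Localization.AtPrime P) x ∈
      (J.map (algebraMap A (Localization.AtPrime P))).radical := by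
    rw [IsLocalization.AtPrime.radical_map_of_mem_minimalPrimes _ P J hP]
    exact Ideal.mem_map_of_mem _ hx
  obtain ⟨n, hn⟩ := hrad
  rw [← map_pow, IsLocalization.algebraMap_mem_map_algebraMap_iff P.primeCompl] at hn
  obtain ⟨s, hs, hn⟩ := hn
  rw [Ideal.mem_comap, IsLocalization.algebraMap_mem_map_algebraMap_iff P.primeCompl]
  refine ⟨s, hs, hJ ⟨n + 1, ?_⟩⟩
  rw [show (s * x) ^ (n + 1) = s ^ n * x * (s * x ^ n) by ring]
  exact J.mul_mem_left _ hn

theorem minimalPrimes_subset_associatedPrimes_quotient {A : Type*} [CommRing A]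
    [IsNoetherianRing A] (J : Ideal A) : J.minimalPrimes ⊆ associatedPrimes A (A ⧸ J) := by
  have := Module.associatedPrimes.minimalPrimes_annihilator_subset_associatedPrimes A (A ⧸ J)
  rwa [Ideal.annihilator_quotient] at this

theorem associatedPrimes_quotient_of_isRadical {A : Type*} [CommRing A] [IsNoetherianRing A]
    {J : Ideal A} (hJ : J.IsRadical) : associatedPrimes A (A ⧸ J) = J.minimalPrimes := by
  apply Set.Subset.antisymm
  · intro P hP
    obtain ⟨hPp, x, hx⟩ := isAssociatedPrime_iff.1 hP
    obtain ⟨u, rfl⟩ := Ideal.Quotient.mk_surjective x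
    have hK : ∀ r, r ∈ P ↔ r * u ∈ J := by
      intro r
      rw [hx, Submodule.mem_colon_singleton, Submodule.mem_bot, ← Ideal.Quotient.eq_zero_iff_mem,
        map_mul]
      rfl
    have hJP : J ≤ P := fun r hr => (hK r).2 (J.mul_mem_right _ hr)
    have huJ : u ∉ J := fun hu => hPp.ne_top ((Ideal.eq_top_iff_one _).2 ((hK 1).2 (by simpa)))
    rw [← hJ.radical, ← Ideal.sInf_minimalPrimes, Submodule.mem_sInf] at huJ
    push Not at huJ
    -- With `P = (J : u)` and `u ∉ Q`, `P u ⊆ J ⊆ Q` gives `P ⊆ Q`, and minimality of `Q` gives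
    -- equality.
    obtain ⟨Q, hQ, huQ⟩ := huJ
    have hPQ : P ≤ Q := fun r hr =>
      (hQ.1.1.mem_or_mem (hQ.1.2 ((hK r).1 hr))).resolve_right huQ
    rwa [le_antisymm hPQ (hQ.2 ⟨hPp, hJP⟩ hPQ)]
  · exact minimalPrimes_subset_associatedPrimes_quotient J

/-! ### Symbolic powers inside Frobenius powers. -/

namespace FThreshold

variable {R : Type*} [CommRing R]

theorem bracketPower_eq_map (p : ℕ) [Fact p.Prime] [CharP R p] (I : Ideal R) (e : ℕ) :
    bracketPower I (p ^ e) = I.map (iterateFrobenius R p e) := rfl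

theorem bracketPower_mono {I J : Ideal R} (h : I ≤ J) (q : ℕ) :
    bracketPower I q ≤ bracketPower J q :=
  Ideal.span_mono (Set.image_mono h)

theorem bracketPower_le_self {P : Ideal R} {q : ℕ} (hq : q ≠ 0) : bracketPower P q ≤ P := by
  rw [bracketPower, Ideal.span_le]
  rintro _ ⟨f, hf, rfl⟩
  exact P.pow_mem_of_mem hf q (Nat.pos_of_ne_zero hq)

theorem bracketPower_ne_top {I : Ideal R} (hI : I ≠ ⊤) {q : ℕ} (hq : q ≠ 0) :
    bracketPower I q ≠ ⊤ := fun h =>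
  hI (top_le_iff.1 (h ▸ bracketPower_le_self hq))

theorem maximalIdeal_pow_le_bracketPower {A : Type*} [CommRing A] [IsRegularLocalRing A]
    {h : ℕ} (hA : ringKrullDim A ≤ h) {q n : ℕ} (hn : h * q < n) :
    maximalIdeal A ^ n ≤ bracketPower (maximalIdeal A) q := by
  obtain ⟨S, hcard, hspan⟩ := Submodule.FG.exists_span_finset_card_eq_spanFinrank
    (maximalIdeal A).fg_of_isNoetherianRing
  have hle : S.card ≤ h := by
    rw [← IsRegularLocalRing.spanFinrank_maximalIdeal, ← hcard] at hA
    exact_mod_cast hA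
  calc maximalIdeal A ^ n ≤ maximalIdeal A ^ (S.card * q + 1) :=
        Ideal.pow_le_pow_right (by have := Nat.mul_le_mul_right q hle; omega)
    _ ≤ Ideal.span ((fun s => s ^ q) '' (S : Set A)) := by
        conv_lhs => rw [← hspan]
        exact span_finset_pow_le S q
    _ ≤ _ := Ideal.span_mono (Set.image_mono (hspan ▸ Submodule.subset_span))

theorem bracketPower_map {A B : Type*} [CommRing A] [CommRing B] (f : A →+* B) (J : Ideal A)
    (p : ℕ) [Fact p.Prime] [CharP A p] [CharP B p] (e : ℕ) :
    bracketPower (J.map f) (p ^ e) = (bracketPower J (p ^ e)).map f := by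
  rw [bracketPower_eq_map, bracketPower_eq_map, Ideal.map_map, Ideal.map_map]
  congr 1
  ext x
  simp [iterateFrobenius_def]

/-- For a radical ideal, membership in a Frobenius power may be tested at the minimal primes. -/
theorem mem_bracketPower_of_forall_minimalPrimes [IsRegularRing R] (p : ℕ) [Fact p.Prime]
    [CharP R p] {J : Ideal R} (hJ : J.IsRadical) (e : ℕ) {f : R}
    (hf : ∀ P ∈ J.minimalPrimes, ∃ s ∉ P, s * f ∈ bracketPower J (p ^ e)) :
    f ∈ bracketPower J (p ^ e) := by
  classical
  have hfin : J.minimalPrimes.Finite := J.finite_minimalPrimes_of_isNoetherianRing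
  let K : Ideal R := Submodule.colon (bracketPower J (p ^ e)) {f}
  have hKmem : ∀ s, s ∈ K ↔ s * f ∈ bracketPower J (p ^ e) := fun s => Submodule.mem_colon_singleton
  -- Prime avoidance merges the local multipliers into one `s`. It is a nonzerodivisor modulo `J`,
  -- so by flatness `s ^ p ^ e` is one modulo the Frobenius power.
  obtain ⟨s, hsK, hs⟩ : ∃ s ∈ K, ∀ P ∈ J.minimalPrimes, s ∉ P := by
    by_contra! hcon
    have hsub : (K : Set R) ⊆ ⋃ P ∈ (hfin.toFinset : Set (Ideal R)), ((id P : Ideal R) : Set R) := by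
      intro s hs
      obtain ⟨P, hP, hsP⟩ := hcon s hs
      exact Set.mem_biUnion (x := P) (by simpa using hP) hsP
    rw [Ideal.subset_union_prime ⊥ ⊥ (fun P hP _ _ => ((Set.Finite.mem_toFinset _).1 hP).1.1)]
      at hsub
    obtain ⟨P, hP, hKP⟩ := hsub
    obtain ⟨s, hs, hsf⟩ := hf P ((Set.Finite.mem_toFinset _).1 hP)
    exact hs (hKP ((hKmem s).2 hsf))
  have hnzd : ∀ r, r * s ∈ J → r ∈ J := by
    intro r hr
    rw [← hJ.radical, ← Ideal.sInf_minimalPrimes, Submodule.mem_sInf]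
    intro P hP
    exact (hP.1.1.mem_or_mem (hP.1.2 hr)).resolve_right (hs P hP)
  rw [bracketPower_eq_map]
  refine (iterateFrobenius_flat p e).mem_map_of_mul_mem_map hnzd ?_
  rw [← bracketPower_eq_map, iterateFrobenius_def]
  obtain ⟨k, hk⟩ := Nat.exists_eq_succ_of_ne_zero
    (pow_ne_zero e (Fact.out : p.Prime).ne_zero)
  have hmul : f * s ^ p ^ e = s ^ k * (s * f) := by rw [hk, pow_succ]; ring
  rw [hmul]
  exact Ideal.mul_mem_left _ _ ((hKmem s).1 hsK)

theorem symbolicPower_le_bracketPower [IsRegularRing R] (p : ℕ) [Fact p.Prime]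
    [CharP R p] {J : Ideal R} (hJ : J.IsRadical) {h : ℕ} (hh : bigHeight J ≤ h) (e : ℕ) {n : ℕ}
    (hn : h * p ^ e < n) : symbolicPower J n ≤ bracketPower J (p ^ e) := by
  intro f hf
  refine mem_bracketPower_of_forall_minimalPrimes p hJ e fun P hP => ?_
  have hPp : P.IsPrime := hP.1.1
  have hPa : P ∈ associatedPrimes R (R ⧸ J) := by
    rwa [associatedPrimes_quotient_of_isRadical hJ]
  have hht : P.height ≤ h := (le_iSup₂ (f := fun P (_ : P ∈ associatedPrimes R (R ⧸ J)) =>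
    P.height) P hPa).trans hh
  have hfP : algebraMap R (Localization.AtPrime P) f ∈
      (J ^ n).map (algebraMap R (Localization.AtPrime P)) := by
    simp only [symbolicPower, Submodule.mem_iInf] at hf
    exact hf ⟨P, hPp⟩ hPa
  have hchar : CharP (Localization.AtPrime P) p := by
    rw [CharP.charP_iff_prime_eq_zero (Fact.out : p.Prime), ← map_natCast (algebraMap R _),
      CharP.cast_eq_zero, map_zero]
  have hdim : ringKrullDim (Localization.AtPrime P) ≤ h := by
    rw [IsLocalization.AtPrime.ringKrullDim_eq_height P]
    exact_mod_cast hht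
  have hJm := IsLocalization.AtPrime.map_eq_maximalIdeal_of_mem_minimalPrimes hJ hP
  rw [Ideal.map_pow, hJm] at hfP
  have := maximalIdeal_pow_le_bracketPower hdim hn hfP
  rw [← hJm, bracketPower_map,
    IsLocalization.algebraMap_mem_map_algebraMap_iff P.primeCompl] at this
  obtain ⟨s, hs, hsf⟩ := this
  exact ⟨s, hs, hsf⟩

end FThreshold

end FrobeniusPowers

/-! ### Existence of thresholds as limits of monotone bounded sequences. -/

namespace FThreshold

variable {R : Type*} [CommRing R]

theorem nu_div_le_iff {p : ℕ} (hp : 0 < p) (I : Ideal R) (F : ℕ → Ideal R) (e : ℕ) (x : EReal) :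
    nu I F (p ^ e) / (((p : ℝ) ^ e : ℝ) : EReal) ≤ x ↔
      ∀ r : ℕ, ¬ F r ≤ bracketPower I (p ^ e) →
        ((r : ℝ) : EReal) / (((p : ℝ) ^ e : ℝ) : EReal) ≤ x := by
  have h1 : (0 : EReal) < (((p : ℝ) ^ e : ℝ) : EReal) := by
    rw [EReal.coe_pos]; positivity
  simp only [EReal.div_le_iff_le_mul h1 (EReal.coe_ne_top _), nu, iSup_le_iff]

theorem nu_div_le_of_forall {p : ℕ} (hp : 0 < p) {I I' : Ideal R} {F F' : ℕ → Ideal R} {e : ℕ}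
    (h : ∀ r, ¬ F r ≤ bracketPower I (p ^ e) → ¬ F' r ≤ bracketPower I' (p ^ e)) :
    nu I F (p ^ e) / (((p : ℝ) ^ e : ℝ) : EReal) ≤
      nu I' F' (p ^ e) / (((p : ℝ) ^ e : ℝ) : EReal) := by
  rw [nu_div_le_iff hp]
  exact fun r hr => (nu_div_le_iff hp I' F' e _).1 le_rfl r (h r hr)

theorem exists_hasFThreshold {p : ℕ} (hp : 0 < p) (I : Ideal R) (F : ℕ → Ideal R) (h : ℕ)
    (h0 : ∀ e, ¬ F 0 ≤ bracketPower I (p ^ e))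
    (hstep : ∀ e r, ¬ F r ≤ bracketPower I (p ^ e) → ¬ F (p * r) ≤ bracketPower I (p ^ (e + 1)))
    (hbound : ∀ e r, ¬ F r ≤ bracketPower I (p ^ e) → r ≤ h * p ^ e) :
    ∃ c : ℝ≥0, HasFThreshold p I F c ∧ (c : ℝ≥0∞) ≤ h ∧
      ((c : ℝ) : EReal) = ⨆ e : ℕ, nu I F (p ^ e) / (((p : ℝ) ^ e : ℝ) : EReal) := by
  set a : ℕ → EReal := fun e => nu I F (p ^ e) / (((p : ℝ) ^ e : ℝ) : EReal) with ha
  have hp' : (0 : ℝ) < p := by exact_mod_cast hp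
  have hmono : Monotone a := by
    refine monotone_nat_of_le_succ fun e => ?_
    rw [ha, nu_div_le_iff hp]
    intro r hr
    have h1 := (nu_div_le_iff hp I F (e + 1) _).1 le_rfl (p * r) (hstep e r hr)
    refine le_trans (le_of_eq ?_) h1
    rw [← EReal.coe_div, ← EReal.coe_div]
    congr 1
    push_cast
    rw [pow_succ]
    field_simp
  have hle : ⨆ e, a e ≤ ((h : ℝ) : EReal) := by
    refine iSup_le fun e => ?_
    rw [ha, nu_div_le_iff hp]
    intro r hr
    rw [← EReal.coe_div, EReal.coe_le_coe_iff, div_le_iff₀ (by positivity)]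
    exact_mod_cast hbound e r hr
  -- The index `r = 0` rules out the value `-∞` of `nu`.
  have hge : 0 ≤ ⨆ e, a e := by
    refine le_trans ?_ (le_iSup a 0)
    refine le_trans ?_ ((nu_div_le_iff hp I F 0 _).1 le_rfl 0 (h0 0))
    simp
  have htend := tendsto_atTop_iSup hmono
  obtain ⟨x, hx⟩ : ∃ x : ℝ, (x : EReal) = ⨆ e, a e :=
    ⟨_, EReal.coe_toReal (ne_top_of_le_ne_top (EReal.coe_ne_top _) hle)
      (ne_bot_of_le_ne_bot EReal.zero_ne_bot hge)⟩
  rw [← hx] at hle hge htend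
  refine ⟨⟨x, EReal.coe_nonneg.1 hge⟩, ⟨?_, ?_⟩, ?_, hx⟩
  · exact htend.limsup_eq
  · exact htend.liminf_eq
  · have hxh : x ≤ h := EReal.coe_le_coe_iff.1 hle
    have hle' : (⟨x, EReal.coe_nonneg.1 hge⟩ : ℝ≥0) ≤ (h : ℝ≥0) := hxh
    simpa using ENNReal.coe_le_coe.2 hle'

theorem not_le_bracketPower_succ [IsRegularRing R] (p : ℕ) [hp : Fact p.Prime] [CharP R p]
    {I : Ideal R} {F : ℕ → Ideal R} (hF : ∀ r, ∀ f ∈ F r, f ^ p ∈ F (p * r)) (e r : ℕ)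
    (h : ¬ F r ≤ bracketPower I (p ^ e)) : ¬ F (p * r) ≤ bracketPower I (p ^ (e + 1)) := by
  obtain ⟨f, hf, hfI⟩ := SetLike.not_le_iff_exists.1 h
  intro hle
  have h1 := hle (hF r f hf)
  set Q := bracketPower I (p ^ e) with hQ
  have hsucc : bracketPower I (p ^ (e + 1)) = Q.map (frobenius R p) := by
    rw [hQ, bracketPower_eq_map, bracketPower_eq_map, Ideal.map_map]
    congr 1
    ext x
    simp [iterateFrobenius_def, frobenius_def, pow_succ, pow_mul]
  have hcolon : ∀ r, r * f ∈ Q → r ∈ Submodule.colon Q {f} :=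
    fun r hr => Submodule.mem_colon_singleton.2 hr
  have h2 : (1 : R) ∈ (Submodule.colon Q {f}).map (frobenius R p) :=
    (frobenius_flat_of_isRegularRing p).mem_map_of_mul_mem_map hcolon
      (by rwa [one_mul, frobenius_def, ← hsucc])
  have h3 : (Submodule.colon Q {f}).map (frobenius R p) ≤ Submodule.colon Q {f} :=
    Ideal.map_le_iff_le_comap.2 fun r hr => Ideal.pow_mem_of_mem _ hr p hp.out.pos
  have h4 := Submodule.mem_colon_singleton.1 (h3 h2)
  rw [smul_eq_mul, one_mul] at h4
  exact hfI h4

theorem pow_mem_symbolicPower (𝔞 : Ideal R) (p r : ℕ) {f : R} (hf : f ∈ symbolicPower 𝔞 r) :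
    f ^ p ∈ symbolicPower 𝔞 (p * r) := by
  simp only [symbolicPower, Submodule.mem_iInf, Ideal.mem_comap] at hf ⊢
  intro P hP
  rw [map_pow, mul_comm, pow_mul, Ideal.map_pow]
  exact Ideal.pow_mem_pow (hf P hP) p

theorem symbolicPower_zero (𝔞 : Ideal R) : symbolicPower 𝔞 0 = ⊤ := by
  simp [symbolicPower, Ideal.one_eq_top, Ideal.map_top]

theorem pow_le_symbolicPower (𝔞 : Ideal R) (n : ℕ) : 𝔞 ^ n ≤ symbolicPower 𝔞 n :=
  le_iInf₂ fun _ _ => Ideal.le_comap_map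

/-- Passing to the radical drops the embedded primes from the intersection and enlarges the ideal in
each remaining term. -/
theorem symbolicPower_le_symbolicPower_radical [IsNoetherianRing R] (𝔞 : Ideal R) (n : ℕ) :
    symbolicPower 𝔞 n ≤ symbolicPower 𝔞.radical n := by
  refine le_iInf₂ fun P hP => ?_
  have hP' : P.asIdeal ∈ associatedPrimes R (R ⧸ 𝔞) := by
    rw [associatedPrimes_quotient_of_isRadical 𝔞.radical_isRadical,
      Ideal.radical_minimalPrimes] at hP
    exact minimalPrimes_subset_associatedPrimes_quotient 𝔞 hP
  exact (iInf₂_le P hP').trans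
    (Ideal.comap_mono (Ideal.map_mono (Ideal.pow_right_mono Ideal.le_radical n)))

theorem bigHeight_ne_top [IsNoetherianRing R] (𝔞 : Ideal R) : bigHeight 𝔞 ≠ ⊤ := by
  have hfin : (associatedPrimes R (R ⧸ 𝔞)).Finite := associatedPrimes.finite R (R ⧸ 𝔞)
  have : bigHeight 𝔞 = hfin.toFinset.sup Ideal.height := by
    rw [Finset.sup_eq_iSup, bigHeight]
    simp
  rw [this, ← lt_top_iff_ne_top, Finset.sup_lt_iff (by simp)]
  intro P hP
  have hPp : P.IsPrime := IsAssociatedPrime.isPrime ((Set.Finite.mem_toFinset _).1 hP)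
  exact lt_top_iff_ne_top.2 (Ideal.height_ne_top hPp.ne_top)

end FThreshold

/-! ### The chain of inequalities. -/

theorem proposition5p1 {R : Type*} [CommRing R] [IsRegularRing R]
    (p : ℕ) [Fact p.Prime] [CharP R p]
    (I 𝔞 : Ideal R) (hI₀ : I ≠ ⊥) (hI₁ : I ≠ ⊤) (h𝔞₀ : 𝔞 ≠ ⊥) (h𝔞₁ : 𝔞 ≠ ⊤)
    (h : 𝔞 ≤ I.radical) :
    FThreshold.bigHeight 𝔞.radical ≠ ⊤ ∧
    ∃ cI cRad cOrd : ℝ≥0,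
      FThreshold.HasFThreshold p I.radical (FThreshold.symbolicPower 𝔞) cI ∧
      FThreshold.HasFThreshold p 𝔞.radical (FThreshold.symbolicPower 𝔞.radical) cRad ∧
      FThreshold.HasFThreshold p I.radical (fun n => 𝔞 ^ n) cOrd ∧
      (∀ 𝔭 : Ideal R, 𝔭.IsPrime → I ≤ 𝔭 →
        ∃ cP : ℝ≥0, FThreshold.HasFThreshold p 𝔭 (FThreshold.symbolicPower 𝔞) cP ∧ cP ≤ cI) ∧
      cI ≤ cRad ∧
      (cRad : ℝ≥0∞) ≤ (FThreshold.bigHeight 𝔞.radical : ℝ≥0∞) ∧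
      (cOrd : ℝ≥0∞) ≤ (FThreshold.bigHeight 𝔞.radical : ℝ≥0∞) := by
  open FThreshold in
  have hp : p.Prime := Fact.out
  have hq : ∀ e, p ^ e ≠ 0 := fun e => pow_ne_zero e hp.ne_zero
  have hnt := bigHeight_ne_top 𝔞.radical
  refine ⟨hnt, ?_⟩
  obtain ⟨H, hH⟩ := ENat.ne_top_iff_exists.1 hnt
  have hradI : I.radical ≠ ⊤ := fun h => hI₁ (Ideal.radical_eq_top.1 h)
  have hrada : 𝔞.radical ≠ ⊤ := fun h => h𝔞₁ (Ideal.radical_eq_top.1 h)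
  have hle : 𝔞.radical ≤ I.radical := I.radical_isRadical.radical_le_iff.2 h
  have hzero : ∀ {J : Ideal R} (F : ℕ → Ideal R), J ≠ ⊤ → F 0 = ⊤ →
      ∀ e, ¬ F 0 ≤ bracketPower J (p ^ e) := fun F hJ hF e hF0 =>
    bracketPower_ne_top hJ (hq e) (top_le_iff.1 (hF ▸ hF0))
  -- The only bound that needs the big height; the filtrations for `√I`, `𝔭` and ordinary powers
  -- inherit it by non-containment.
  have hboundRad : ∀ e r, ¬ symbolicPower 𝔞.radical r ≤ bracketPower 𝔞.radical (p ^ e) →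
      r ≤ H * p ^ e := fun e r hr => by
    by_contra hlt
    exact hr (symbolicPower_le_bracketPower p 𝔞.radical_isRadical hH.ge e (not_le.1 hlt))
  have hRad_of_I : ∀ e r, ¬ symbolicPower 𝔞 r ≤ bracketPower I.radical (p ^ e) →
      ¬ symbolicPower 𝔞.radical r ≤ bracketPower 𝔞.radical (p ^ e) := fun e r hr hr' =>
    hr (((symbolicPower_le_symbolicPower_radical 𝔞 r).trans hr').trans (bracketPower_mono hle _))
  have hI_of_P : ∀ 𝔭 : Ideal R, 𝔭.IsPrime → I ≤ 𝔭 → ∀ e r,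
      ¬ symbolicPower 𝔞 r ≤ bracketPower 𝔭 (p ^ e) →
      ¬ symbolicPower 𝔞 r ≤ bracketPower I.radical (p ^ e) := fun 𝔭 h𝔭 hI𝔭 e r hr hr' =>
    hr (hr'.trans (bracketPower_mono (h𝔭.radical_le_iff.2 hI𝔭) _))
  have hsymb : ∀ (J : Ideal R) (r : ℕ), ∀ f ∈ symbolicPower J r, f ^ p ∈ symbolicPower J (p * r) :=
    fun J r f hf => pow_mem_symbolicPower J p r hf
  obtain ⟨cRad, hcRad, hRadle, hRad⟩ := exists_hasFThreshold hp.pos 𝔞.radical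
    (symbolicPower 𝔞.radical) H (hzero _ hrada (symbolicPower_zero _))
    (not_le_bracketPower_succ p (hsymb _)) hboundRad
  obtain ⟨cI, hcI, -, hcIeq⟩ := exists_hasFThreshold hp.pos I.radical
    (symbolicPower 𝔞) H (hzero _ hradI (symbolicPower_zero _))
    (not_le_bracketPower_succ p (hsymb _)) fun e r hr => hboundRad e r (hRad_of_I e r hr)
  obtain ⟨cOrd, hcOrd, hOrdle, -⟩ := exists_hasFThreshold hp.pos I.radical
    (fun n => 𝔞 ^ n) H (hzero _ hradI (by simp [Ideal.one_eq_top]))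
    (not_le_bracketPower_succ p fun r f hf => by
      rw [mul_comm, pow_mul]; exact Ideal.pow_mem_pow hf p)
    fun e r hr => hboundRad e r (hRad_of_I e r fun hr' =>
      hr ((pow_le_symbolicPower 𝔞 r).trans hr'))
  refine ⟨cI, cRad, cOrd, hcI, hcRad, hcOrd, ?_, ?_, ?_, ?_⟩
  · intro 𝔭 h𝔭 hI𝔭
    obtain ⟨cP, hcP, -, hcPeq⟩ := exists_hasFThreshold hp.pos 𝔭
      (symbolicPower 𝔞) H (hzero _ h𝔭.ne_top (symbolicPower_zero _))
      (not_le_bracketPower_succ p (hsymb _)) fun e r hr =>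
        hboundRad e r (hRad_of_I e r (hI_of_P 𝔭 h𝔭 hI𝔭 e r hr))
    refine ⟨cP, hcP, NNReal.coe_le_coe.1 (EReal.coe_le_coe_iff.1 ?_)⟩
    rw [hcPeq, hcIeq]
    exact iSup_mono fun e => nu_div_le_of_forall hp.pos (hI_of_P 𝔭 h𝔭 hI𝔭 e)
  · refine NNReal.coe_le_coe.1 (EReal.coe_le_coe_iff.1 ?_)
    rw [hcIeq, hRad]
    exact iSup_mono fun e => nu_div_le_of_forall hp.pos (hRad_of_I e)
  · rw [← hH]; simpa using hRadle
  · rw [← hH]; simpa using hOrdle
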